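/- Let $h(t)$, $t\in\mathbb R$, be a stationary Rayleigh flat fading channel of unit power, i.e. a zero-mean, circularly symmetric complex Gaussian process with $\mathbb E[h(t)h^\star(t-\tau)]=\rho_h(\tau)$ for all $t,\tau$ and $\mathbb E|h(t)|^2=\rho_h(0)=1$. Let $T_s>0$ be the symbol duration, $\eta>0$ the average SNR, $\varrho_1=|\rho_h(T_s)|<1$, and let $\mathcal I_{\rm th}\ge 0$ be a threshold. Let $\alpha_l=|h(lT_s)|$ and let $\mathcal I_l=\log_2(1+\eta\alpha_l^2)$, $l=1,2,\dots$, be the instantaneous mutual information (IMI) of the SISO system; put $X_l=1$ if $\mathcal I_l\ge\mathcal I_{\rm th}$ and $X_l=0$ otherwise. For $L\ge2$ let the level-crossing rate $N_{\mathcal I}(\mathcal I_{\rm th})$ be the expected number of down-crossings (indices $2\le l\le L$ with $X_{l-1}=1$, $X_l=0$) divided by $(L-1)T_s$, and let the average outage duration $\bar t_{\mathcal I}(\mathcal I_{\rm th})$ be the expected time spent in outage, $T_s\,\mathbb E\,\#\{2\le l\le L:\mathcal I_l<\mathcal I_{\rm th}\}$, divided by the expected number of down-crossings. Write $\Gamma(a,z)=\int_z^\infty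 t^{a-1}e^{-t}\,dt$. (1) For every $L\ge2$ and every $l\ge2$, $$N_{\mathcal I}(\mathcal I_{\rm th})=\frac{\mathbb E\big[\sum_{j=2}^L(X_j-X_{j-1})^2\big]}{2(L-1)T_s}=\frac{\Pr\{X_l=1\}-\Pr\{X_l=1,X_{l-1}=1\}}{T_s}$$ $$=\frac{1}{T_s}\left(e^{-\frac{2^{\mathcal I_{\rm th}}-1}{\eta}}-(1-\varrho_1^2)\sum_{k=0}^\infty\left[\frac{\varrho_1^k}{k!}\,\Gamma\!\left(k+1,\frac{2^{\mathcal I_{\rm th}}-1}{\eta(1-\varrho_1^2)}\right)\right]^2\right),$$ and the series converges. (2) For every $l\ge1$ the cumulative distribution function of $\mathcal I_l$ satisfies $F_{\mathcal I}(\mathcal I_{\rm th})=\Pr\{\mathcal I_l\le\mathcal I_{\rm th}\}=1-e^{-(2^{\mathcal I_{\rm th}}-1)/\eta}$. (3) If $\mathcal I_{\rm th}>0$, then $N_{\mathcal I}(\mathcal I_{\rm th})>0$ and, for every $L\ge2$, the average outage duration normalized by $T_s$ is $$\frac{\bar t_{\mathcal I}(\mathcal I_{\rm th})}{T_s}=\frac{F_{\mathcal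 I}(\mathcal I_{\rm th})}{T_sN_{\mathcal I}(\mathcal I_{\rm th})}=\frac{1-e^{-\frac{2^{\mathcal I_{\rm th}}-1}{\eta}}}{e^{-\frac{2^{\mathcal I_{\rm th}}-1}{\eta}}-(1-\varrho_1^2)\sum_{k=0}^\infty\left[\frac{\varrho_1^k}{k!}\,\Gamma\!\left(k+1,\frac{2^{\mathcal I_{\rm th}}-1}{\eta(1-\varrho_1^2)}\right)\right]^2}.$$ -/

import Mathlib

open MeasureTheory ProbabilityTheory

noncomputable section

namespace SISO

/-- The upper incomplete gamma function `Γ(a, z) = ∫_z^∞ t^(a-1) e^(-t) dt`. -/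
def upperGamma (a z : ℝ) : ℝ := ∫ t in Set.Ioi z, t ^ (a - 1) * Real.exp (-t)

/-- `h` is a stationary Rayleigh flat fading channel of unit power with correlation
coefficient `ρ`: a zero-mean circularly symmetric complex Gaussian random process with
`E[h(t) h(t - τ)^*] = ρ(τ)` and `E[|h(t)|^2] = ρ(0) = 1`. -/
structure IsRayleighChannel {Ω : Type*} [MeasurableSpace Ω] (μ : Measure Ω)
    (h : ℝ → Ω → ℂ) (ρ : ℝ → ℂ) : Prop where
  /-- all finite families of real and imaginary parts of samples are jointly Gaussian -/
  gaussian : IsGaussianProcess h μ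
  zero_mean : ∀ t, ∫ ω, h t ω ∂μ = 0
  /-- circular symmetry: the pseudo-covariance vanishes -/
  circular : ∀ s t, ∫ ω, h s ω * h t ω ∂μ = 0
  correlation : ∀ t τ, ∫ ω, h t ω * (starRingEnd ℂ) (h (t - τ) ω) ∂μ = ρ τ
  unit_power : ρ 0 = 1

variable {Ω : Type*}

/-- The envelope `α_l = |h(l Ts)|` of the `l`-th sample of the channel. -/
def envelope (h : ℝ → Ω → ℂ) (Ts : ℝ) (l : ℕ) (ω : Ω) : ℝ := ‖h (l * Ts) ω‖

/-- The instantaneous mutual information `I_l = log₂ (1 + η α_l²)`. -/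
def imi (h : ℝ → Ω → ℂ) (Ts η : ℝ) (l : ℕ) (ω : Ω) : ℝ :=
  Real.logb 2 (1 + η * envelope h Ts l ω ^ 2)

open Classical in
/-- The binary sequence `X_l`: `1` if `I_l ≥ Ith`, and `0` if `I_l < Ith`. -/
def binary (h : ℝ → Ω → ℂ) (Ts η Ith : ℝ) (l : ℕ) (ω : Ω) : ℝ :=
  if Ith ≤ imi h Ts η l ω then 1 else 0

/-- The number of (up- and down-) crossings of the level `Ith` among the samples
`1, …, L`. -/
def crossings (h : ℝ → Ω → ℂ) (Ts η Ith : ℝ) (L : ℕ) (ω : Ω) : ℝ :=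
  ∑ l ∈ Finset.Icc 2 L, (binary h Ts η Ith l ω - binary h Ts η Ith (l - 1) ω) ^ 2

open Classical in
/-- The number of down-crossings among the samples `1, …, L`: the number of
`l ∈ {2, …, L}` with `X_{l-1} = 1` and `X_l = 0`. -/
def downCrossings (h : ℝ → Ω → ℂ) (Ts η Ith : ℝ) (L : ℕ) (ω : Ω) : ℕ :=
  ((Finset.Icc 2 L).filter
    fun l => binary h Ts η Ith (l - 1) ω = 1 ∧ binary h Ts η Ith l ω = 0).card

open Classical in
/-- The time spent in outage (`I_l < Ith`) by the symbols `l = 2, …, L`,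
each of duration `Ts`. -/
def outageTime (h : ℝ → Ω → ℂ) (Ts η Ith : ℝ) (L : ℕ) (ω : Ω) : ℝ :=
  Ts * (((Finset.Icc 2 L).filter fun l => imi h Ts η l ω < Ith).card : ℝ)

variable [MeasurableSpace Ω]

/-- The expected rate (per unit time) of all crossings of the level `Ith`, over `L` samples. -/
def crossingRate (μ : Measure Ω) (h : ℝ → Ω → ℂ) (Ts η Ith : ℝ) (L : ℕ) : ℝ :=
  (∫ ω, crossings h Ts η Ith L ω ∂μ) / (((L : ℝ) - 1) * Ts)

/-- The level-crossing rate: the expected rate (per unit time) of down-crossings of the level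
`Ith`, over `L` samples. -/
def lcr (μ : Measure Ω) (h : ℝ → Ω → ℂ) (Ts η Ith : ℝ) (L : ℕ) : ℝ :=
  (∫ ω, (downCrossings h Ts η Ith L ω : ℝ) ∂μ) / (((L : ℝ) - 1) * Ts)

/-- The average outage duration: the expected time spent in outage divided by the expected
number of outages (down-crossings), over `L` samples. -/
def aod (μ : Measure Ω) (h : ℝ → Ω → ℂ) (Ts η Ith : ℝ) (L : ℕ) : ℝ :=
  (∫ ω, outageTime h Ts η Ith L ω ∂μ) / ∫ ω, (downCrossings h Ts η Ith L ω : ℝ) ∂μ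

/-- The cumulative distribution function of `I_l`. -/
def imiCDF (μ : Measure Ω) (h : ℝ → Ω → ℂ) (Ts η : ℝ) (l : ℕ) (x : ℝ) : ℝ :=
  μ.real {ω | imi h Ts η l ω ≤ x}

end SISO

end

open scoped Real ENNReal ComplexConjugate

/-! A down-crossing has indicator `X_{l-1} (1 - X_l)`, so every rate and duration reduces to two
probabilities: one squared envelope being at least `x = (2^Ith - 1)/η`, and two consecutive ones
being so. The first is `e^{-x}`, since `|Z|²` is exponential for a standard complex Gaussian `Z`.

For the second, `map_prodMk_eq_of_correlation` writes the pair as `(Z, r Z + √(1-|r|²) W)` with `Z`,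
`W` independent. Given `Z`, the second squared modulus is a scaled noncentral chi-square, i.e. a
Poisson mixture of Gamma laws (`lintegral_norm_sq_add_stdComplexGaussian`, from polar coordinates
and the Bessel series). Averaging over `|Z|²` yields the same incomplete gamma factor again, hence
the squares (`lintegral_indicator_mul_exceedanceKernel`). The series are summed in `ℝ≥0∞`;
convergence follows because the total is a probability.

For a positive threshold the rate is positive because the conditional exceedance probability never
vanishes. -/

/-! ### The angular integral and its Bessel series -/

lemma Complex.exp_two_re_mul_eq (ζ : ℂ) (θ : ℝ) :
    (Real.exp (2 * (ζ * Complex.exp (θ * Complex.I)).re) : ℂ) =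
      Complex.exp (ζ * Complex.exp (θ * Complex.I)) *
        Complex.exp (conj ζ * Complex.exp (-(θ * Complex.I))) := by
  have h : conj ζ * Complex.exp (-(θ * Complex.I)) = conj (ζ * Complex.exp (θ * Complex.I)) := by
    rw [map_mul, ← Complex.exp_conj]; simp
  rw [h, ← Complex.exp_add, Complex.add_conj]
  push_cast; rfl

/-- Cauchy's formula on the unit circle for the `k`-th derivative of `z ↦ e^{ζ z}` at `0`. -/
lemma intervalIntegral_exp_mul_pow_exp_neg (ζ : ℂ) (k : ℕ) :
    ∫ θ in (0 : ℝ)..2 * π, Complex.exp (ζ * Complex.exp (θ * Complex.I)) *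
      Complex.exp (-(θ * Complex.I)) ^ k = 2 * π * (ζ ^ k / k.factorial) := by
  have h := (show Differentiable ℂ fun z : ℂ => Complex.exp (ζ * z) by
    fun_prop).diffContOnCl (s := Metric.ball 0 1) |>.circleIntegral_one_div_sub_center_pow_smul
      one_pos k
  have h2 : iteratedDeriv k (fun z : ℂ => Complex.exp (ζ * z)) 0 = ζ ^ k := by
    simp
  rw [h2, circleIntegral] at h
  have h3 : ∀ θ : ℝ, deriv (circleMap 0 1) θ • (1 / (circleMap 0 1 θ - 0) ^ (k + 1)) •
      Complex.exp (ζ * circleMap 0 1 θ) =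
        Complex.I * (Complex.exp (ζ * Complex.exp (θ * Complex.I)) *
          Complex.exp (-(θ * Complex.I)) ^ k) := by
    intro θ
    have := Complex.exp_ne_zero (θ * Complex.I)
    simp only [deriv_circleMap, circleMap_zero, Complex.ofReal_one, one_mul, sub_zero, smul_eq_mul,
      Complex.exp_neg, inv_pow, pow_succ]
    field_simp
  simp only [h3] at h
  rw [intervalIntegral.integral_const_mul] at h
  apply mul_left_cancel₀ Complex.I_ne_zero
  rw [h, smul_eq_mul]; ring

/-- Only the factor `exp (conj ζ e^{-iθ})` is expanded; each term is then a Fourier coefficient of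
the other factor. The sum is `2π I₀(2‖ζ‖)`. -/
lemma hasSum_bessel_intervalIntegral (ζ : ℂ) :
    HasSum (fun k : ℕ => 2 * π * ((‖ζ‖ ^ 2) ^ k / (k.factorial : ℝ) ^ 2))
      (∫ θ in (-π)..π, Real.exp (2 * (ζ * Complex.exp (θ * Complex.I)).re)) := by
  -- Polar coordinates use `(-π, π)`, circle integrals `(0, 2π)`; periodicity reconciles them.
  have hper : Function.Periodic
      (fun θ : ℝ => Real.exp (2 * (ζ * Complex.exp (θ * Complex.I)).re)) (2 * π) := by
    intro θ
    have : ((θ + 2 * π : ℝ) : ℂ) * Complex.I = θ * Complex.I + 2 * π * Complex.I := by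
      push_cast; ring
    simp only [this, Complex.exp_periodic _]
  have hshift := hper.intervalIntegral_add_eq (-π) 0
  rw [show -π + 2 * π = π by ring, zero_add] at hshift
  rw [hshift, ← Complex.hasSum_ofReal, ← intervalIntegral.integral_ofReal]
  simp only [Complex.exp_two_re_mul_eq]
  have key := intervalIntegral.hasSum_integral_of_dominated_convergence
    (μ := volume) (a := 0) (b := 2 * π) (ι := ℕ)
    (F := fun k θ => Complex.exp (ζ * Complex.exp (θ * Complex.I)) *
      ((k.factorial : ℂ)⁻¹ * (conj ζ * Complex.exp (-(θ * Complex.I))) ^ k))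
    (f := fun θ => Complex.exp (ζ * Complex.exp (θ * Complex.I)) *
        Complex.exp (conj ζ * Complex.exp (-(θ * Complex.I))))
    (fun k _ => Real.exp ‖ζ‖ * (‖ζ‖ ^ k / k.factorial)) ?_ ?_ ?_ ?_ ?_
  · have hterm : (fun k : ℕ => ((2 * π * ((‖ζ‖ ^ 2) ^ k / (k.factorial : ℝ) ^ 2) : ℝ) : ℂ)) =
        fun k : ℕ => ∫ θ in (0 : ℝ)..2 * π, Complex.exp (ζ * Complex.exp (θ * Complex.I)) *
          ((k.factorial : ℂ)⁻¹ * (conj ζ * Complex.exp (-(θ * Complex.I))) ^ k) := by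
      funext k
      have : ∀ θ : ℝ, Complex.exp (ζ * Complex.exp (θ * Complex.I)) *
          ((k.factorial : ℂ)⁻¹ * (conj ζ * Complex.exp (-(θ * Complex.I))) ^ k) =
          ((k.factorial : ℂ)⁻¹ * conj ζ ^ k) * (Complex.exp (ζ * Complex.exp (θ * Complex.I)) *
            Complex.exp (-(θ * Complex.I)) ^ k) := by intro θ; ring
      simp only [this]
      rw [intervalIntegral.integral_const_mul, intervalIntegral_exp_mul_pow_exp_neg]
      push_cast
      rw [← Complex.mul_conj']
      ring
    rw [hterm]
    exact key
  · intro k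
    exact Continuous.aestronglyMeasurable (by fun_prop)
  · intro k
    filter_upwards with θ _
    have h1 : ‖Complex.exp (θ * Complex.I)‖ = 1 := Complex.norm_exp_ofReal_mul_I θ
    have h2 : ‖Complex.exp (-(θ * Complex.I))‖ = 1 := by
      rw [Complex.exp_neg, norm_inv, h1, inv_one]
    rw [norm_mul, norm_mul, norm_pow, norm_mul, h2, norm_inv, Complex.norm_natCast,
      Complex.norm_conj, mul_one, inv_mul_eq_div]
    gcongr
    refine (Complex.norm_exp_le_exp_norm _).trans ?_
    rw [norm_mul, h1, mul_one]
  · filter_upwards with θ _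
    exact (Real.summable_pow_div_factorial _).mul_left _
  · exact intervalIntegrable_const
  · filter_upwards with θ _
    refine HasSum.mul_left _ ?_
    have := NormedSpace.expSeries_div_hasSum_exp (conj ζ * Complex.exp (-(θ * Complex.I)))
    rw [← Complex.exp_eq_exp_ℂ] at this
    simpa [div_eq_inv_mul] using this

lemma lintegral_exp_two_re (ζ : ℂ) :
    ∫⁻ θ in Set.Ioo (-π) π, ENNReal.ofReal
        (Real.exp (2 * (ζ * Complex.exp (θ * Complex.I)).re)) =
      ∑' k : ℕ, ENNReal.ofReal (2 * π * ((‖ζ‖ ^ 2) ^ k / (k.factorial : ℝ) ^ 2)) := by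
  have h := hasSum_bessel_intervalIntegral ζ
  rw [← ENNReal.ofReal_tsum_of_nonneg (fun k => by positivity) h.summable, h.tsum_eq,
    intervalIntegral.integral_of_le (by linarith [Real.pi_pos]), integral_Ioc_eq_integral_Ioo,
    ofReal_integral_eq_lintegral_ofReal]
  · exact (Continuous.integrableOn_Icc (by fun_prop)).mono_set Set.Ioo_subset_Icc_self
  · filter_upwards with θ using by positivity

/-! ### The standard complex Gaussian and its squared modulus -/

/-- The standard circularly symmetric complex Gaussian measure, of density `e^(-|z|²) / π`. -/
noncomputable def stdComplexGaussian : Measure ℂ :=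
  volume.withDensity fun z => ENNReal.ofReal (Real.exp (-‖z‖ ^ 2) / π)

/-- Under the standard complex Gaussian measure `|c + z|²` is a Poisson mixture of Gamma laws. -/
lemma lintegral_norm_sq_add_stdComplexGaussian (c : ℂ) {f : ℝ → ℝ≥0∞} (hf : Measurable f) :
    ∫⁻ z, f (‖c + z‖ ^ 2) ∂stdComplexGaussian =
      ∫⁻ u in Set.Ioi 0, ∑' k : ℕ, f u *
        (ENNReal.ofReal (Real.exp (-‖c‖ ^ 2) * (‖c‖ ^ 2) ^ k / k.factorial) *
          ENNReal.ofReal (u ^ k * Real.exp (-u) / k.factorial)) := by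
  have hdens : Measurable fun z : ℂ => ENNReal.ofReal (Real.exp (-‖z‖ ^ 2) / π) := by fun_prop
  rw [stdComplexGaussian, lintegral_withDensity_eq_lintegral_mul _ hdens (by fun_prop)]
  simp only [Pi.mul_apply]
  -- Translating by `c` moves the shift onto the density, so that `f` sees only the radius.
  rw [← lintegral_sub_right_eq_self _ c]
  simp only [add_sub_cancel]
  rw [← Complex.lintegral_comp_polarCoord_symm, polarCoord_target,
    Measure.volume_eq_prod, ← Measure.prod_restrict, lintegral_prod _ (by
      simp only [Complex.polarCoord_symm_apply]; fun_prop)]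
  -- The cross term of `‖s e^{iθ} - c‖²` gives the Bessel integral with `ζ = s conj c`. The factor
  -- `2 s` is set apart as the Jacobian of `u = s²`.
  have hinner : ∀ s ∈ Set.Ioi (0 : ℝ), ∫⁻ θ in Set.Ioo (-π) π, ENNReal.ofReal s •
      (ENNReal.ofReal (Real.exp (-‖Complex.polarCoord.symm (s, θ) - c‖ ^ 2) / π) *
        f (‖Complex.polarCoord.symm (s, θ)‖ ^ 2)) =
      ENNReal.ofReal (2 * s) * ∑' k : ℕ, f (s ^ 2) *
        (ENNReal.ofReal (Real.exp (-‖c‖ ^ 2) * (‖c‖ ^ 2) ^ k / k.factorial) *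
          ENNReal.ofReal ((s ^ 2) ^ k * Real.exp (-(s ^ 2)) / k.factorial)) := by
    intro s hs
    have hs : 0 < s := hs
    have hpt : ∀ θ : ℝ, ENNReal.ofReal s •
      (ENNReal.ofReal (Real.exp (-‖Complex.polarCoord.symm (s, θ) - c‖ ^ 2) / π) *
        f (‖Complex.polarCoord.symm (s, θ)‖ ^ 2)) =
        (f (s ^ 2) * ENNReal.ofReal (s * Real.exp (-‖c‖ ^ 2) * Real.exp (-(s ^ 2)) / π)) *
        ENNReal.ofReal
          (Real.exp (2 * ((s * conj c) * Complex.exp (θ * Complex.I)).re)) := by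
      intro θ
      have hz : Complex.polarCoord.symm (s, θ) = s * Complex.exp (θ * Complex.I) := by
        rw [Complex.polarCoord_symm_apply, Complex.exp_mul_I]; simp
      have hn : ‖(s : ℂ) * Complex.exp (θ * Complex.I)‖ = s := by
        rw [norm_mul, Complex.norm_exp_ofReal_mul_I, mul_one, Complex.norm_real,
          Real.norm_of_nonneg hs.le]
      have hsub : ‖(s : ℂ) * Complex.exp (θ * Complex.I) - c‖ ^ 2 = s ^ 2 + ‖c‖ ^ 2 -
          2 * ((s * conj c) * Complex.exp (θ * Complex.I)).re := by
        rw [Complex.sq_norm, Complex.normSq_sub, ← Complex.sq_norm, ← Complex.sq_norm, hn]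
        congr 3; ring_nf
      rw [hz, hn, hsub, smul_eq_mul, mul_comm (ENNReal.ofReal (_ / π)), mul_left_comm,
        ← ENNReal.ofReal_mul hs.le, mul_assoc (f _), ← ENNReal.ofReal_mul (by positivity)]
      congr 2
      rw [show -(s ^ 2 + ‖c‖ ^ 2 - 2 * ((s * conj c) * Complex.exp (θ * Complex.I)).re) =
        -‖c‖ ^ 2 + -(s ^ 2) + 2 * ((s * conj c) * Complex.exp (θ * Complex.I)).re by ring,
        Real.exp_add, Real.exp_add]
      ring
    simp only [hpt]
    rw [lintegral_const_mul _ (by fun_prop), lintegral_exp_two_re, ← ENNReal.tsum_mul_left,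
      ← ENNReal.tsum_mul_left]
    congr with k
    rw [mul_assoc, mul_left_comm (ENNReal.ofReal (2 * s)), ← ENNReal.ofReal_mul (by positivity),
      ← ENNReal.ofReal_mul (by positivity), ← ENNReal.ofReal_mul (by positivity)]
    congr 2
    rw [norm_mul, Complex.norm_real, Complex.norm_conj, Real.norm_of_nonneg hs.le, mul_pow, mul_pow]
    field_simp
  rw [setLIntegral_congr_fun measurableSet_Ioi hinner]
  have himg : (fun s : ℝ => s ^ 2) '' Set.Ioi 0 = Set.Ioi 0 := by
    ext u
    constructor
    · rintro ⟨s, hs, rfl⟩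
      exact pow_pos (Set.mem_Ioi.1 hs) 2
    · intro hu
      exact ⟨√u, Real.sqrt_pos.2 hu, Real.sq_sqrt (Set.mem_Ioi.1 hu).le⟩
  have hchange := lintegral_image_eq_lintegral_abs_deriv_mul measurableSet_Ioi
    (f := fun s : ℝ => s ^ 2) (f' := fun s => 2 * s) (s := Set.Ioi 0)
    (fun s _ => by simpa using (hasDerivAt_pow 2 s).hasDerivWithinAt)
    (fun s hs t ht hst =>
      (pow_left_inj₀ (Set.mem_Ioi.1 hs).le (Set.mem_Ioi.1 ht).le two_ne_zero).1 hst)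
    (fun u => ∑' k : ℕ, f u *
        (ENNReal.ofReal (Real.exp (-‖c‖ ^ 2) * (‖c‖ ^ 2) ^ k / k.factorial) *
          ENNReal.ofReal (u ^ k * Real.exp (-u) / k.factorial)))
  rw [himg] at hchange
  rw [hchange]
  refine setLIntegral_congr_fun measurableSet_Ioi fun s hs => ?_
  have hs : 0 < s := hs
  simp only [abs_of_pos (mul_pos two_pos hs)]

lemma map_gaussianReal_prod_eq_stdComplexGaussian :
    ((gaussianReal 0 (1 / 2)).prod (gaussianReal 0 (1 / 2))).map
      Complex.measurableEquivRealProd.symm = stdComplexGaussian := by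
  have hv : (1 / 2 : NNReal) ≠ 0 := by norm_num
  rw [gaussianReal_of_var_ne_zero _ hv, prod_withDensity (measurable_gaussianPDF _ _)
    (measurable_gaussianPDF _ _)]
  refine Measure.ext_of_lintegral _ fun f hf => ?_
  have hm : Measurable fun z : ℝ × ℝ => gaussianPDF 0 (1 / 2) z.1 * gaussianPDF 0 (1 / 2) z.2 :=
    ((measurable_gaussianPDF _ _).comp measurable_fst).mul
      ((measurable_gaussianPDF _ _).comp measurable_snd)
  rw [lintegral_map_equiv, lintegral_withDensity_eq_lintegral_mul _ hm (by fun_prop),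
    stdComplexGaussian, lintegral_withDensity_eq_lintegral_mul _ (by fun_prop) hf,
    ← Complex.volume_preserving_equiv_real_prod.symm.lintegral_comp_emb
      Complex.measurableEquivRealProd.symm.measurableEmbedding, ← Measure.volume_eq_prod]
  refine lintegral_congr fun p => ?_
  simp only [Pi.mul_apply, gaussianPDF]
  congr 1
  rw [← ENNReal.ofReal_mul (gaussianPDFReal_nonneg _ _ _), Complex.sq_norm, Complex.normSq_apply]
  congr 1
  simp only [gaussianPDFReal, Complex.measurableEquivRealProd_symm_apply, sub_zero]
  have h2 : (2 * ((1 / 2 : NNReal) : ℝ)) = 1 := by norm_num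
  rw [mul_right_comm 2 π, h2, one_mul, div_one, div_one, mul_mul_mul_comm,
    ← Real.exp_add, ← mul_inv, Real.mul_self_sqrt Real.pi_pos.le]
  rw [inv_mul_eq_div]
  ring_nf

/-! ### Circularly symmetric Gaussian vectors and their second moments -/

section CircularGaussian

variable {Ω : Type*} [MeasurableSpace Ω] {μ : Measure Ω}

/-- This is `Re a · Re b = Re (a b + a conj b) / 2`; it splits real covariances into
pseudo-covariance and covariance. -/
lemma Complex.inner_mul_inner_eq (x y z w : ℂ) :
    inner ℝ x z * inner ℝ y w =
      (conj x * conj y * (z * w) + conj x * y * (z * conj w)).re / 2 := by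
  simp [Complex.inner]
  ring

/-- The covariance of real projections of two centred complex variables. -/
lemma covariance_inner_eq [IsProbabilityMeasure μ] {X Y : Ω → ℂ} (hX : MemLp X 2 μ)
    (hY : MemLp Y 2 μ) (hX0 : ∫ ω, X ω ∂μ = 0) (x y : ℂ) :
    cov[fun ω => inner ℝ x (X ω), fun ω => inner ℝ y (Y ω); μ] =
      (conj x * conj y * (∫ ω, X ω * Y ω ∂μ) + conj x * y * ∫ ω, X ω * conj (Y ω) ∂μ).re / 2 := by
  have hXY : Integrable (fun ω => X ω * Y ω) μ := hX.integrable_mul hY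
  have hXY' : Integrable (fun ω => X ω * conj (Y ω)) μ := hX.integrable_mul hY.star
  rw [covariance_eq_sub (hX.const_inner x) (hY.const_inner y),
    integral_inner (hX.integrable (by norm_num)), hX0, inner_zero_right, zero_mul, sub_zero]
  simp only [Pi.mul_apply, Complex.inner_mul_inner_eq]
  rw [integral_div, ← integral_const_mul, ← integral_const_mul, ← integral_add
    (hXY.const_mul _) (hXY'.const_mul _)]
  congr 1
  exact integral_re ((hXY.const_mul _).add (hXY'.const_mul _))

/-- The moments make the real and imaginary parts uncorrelated, each of variance `1/2`; joint
Gaussianity turns this into independence. -/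
lemma map_eq_stdComplexGaussian {Z : Ω → ℂ} (hZ : HasGaussianLaw Z μ) (h0 : ∫ ω, Z ω ∂μ = 0)
    (hcirc : ∫ ω, Z ω * Z ω ∂μ = 0) (hvar : ∫ ω, Z ω * conj (Z ω) ∂μ = 1) :
    μ.map Z = stdComplexGaussian := by
  have := hZ.isProbabilityMeasure
  have hL2 : MemLp Z 2 μ := hZ.memLp_two
  have hre : ∀ z : ℂ, inner ℝ 1 z = z.re := fun z => by simp [Complex.inner]
  have him : ∀ z : ℂ, inner ℝ Complex.I z = z.im := fun z => by simp [Complex.inner]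
  have hcov := covariance_inner_eq hL2 hL2 h0
  simp only [hcirc, hvar] at hcov
  have hpair : HasGaussianLaw (fun ω => ((Z ω).re, (Z ω).im)) μ :=
    hZ.map_fun (Complex.equivRealProdCLM : ℂ →L[ℝ] ℝ × ℝ)
  have hind : IndepFun (fun ω => (Z ω).re) (fun ω => (Z ω).im) μ := by
    refine hpair.indepFun_of_covariance_eq_zero ?_
    have := hcov 1 Complex.I
    simpa [hre, him] using this
  have hhalf : (2⁻¹ : ℝ).toNNReal = 2⁻¹ := by rw [Real.toNNReal_inv, Real.toNNReal_ofNat]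
  have hR : μ.map (fun ω => (Z ω).re) = gaussianReal 0 (1 / 2) := by
    rw [hpair.fst.map_eq_gaussianReal, ← covariance_self hpair.fst.aemeasurable]
    have := hcov 1 1
    simp only [hre] at this
    rw [this, show (fun ω => (Z ω).re) = fun ω => inner ℝ 1 (Z ω) from funext fun ω => (hre _).symm,
      integral_inner (hL2.integrable (by norm_num)), h0]
    simp [hhalf]
  have hI : μ.map (fun ω => (Z ω).im) = gaussianReal 0 (1 / 2) := by
    rw [hpair.snd.map_eq_gaussianReal, ← covariance_self hpair.snd.aemeasurable]
    have := hcov Complex.I Complex.I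
    simp only [him] at this
    rw [this, show (fun ω => (Z ω).im) = fun ω => inner ℝ Complex.I (Z ω) from
      funext fun ω => (him _).symm, integral_inner (hL2.integrable (by norm_num)), h0]
    simp [hhalf]
  rw [← map_gaussianReal_prod_eq_stdComplexGaussian]
  nth_rewrite 1 [← hR]
  rw [← hI, ← (indepFun_iff_map_prod_eq_prod_map_map hpair.fst.aemeasurable
      hpair.snd.aemeasurable).1 hind,
    AEMeasurable.map_map_of_aemeasurable (by fun_prop) hpair.aemeasurable]
  rfl

/-- Both complex moments are needed to kill the covariance of all real projections. Centring one
variable suffices, as the product of means then vanishes. -/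
lemma indepFun_of_uncorrelated {X Y : Ω → ℂ} (hXY : HasGaussianLaw (fun ω => (X ω, Y ω)) μ)
    (hX0 : ∫ ω, X ω ∂μ = 0)
    (h1 : ∫ ω, X ω * Y ω ∂μ = 0) (h2 : ∫ ω, X ω * conj (Y ω) ∂μ = 0) :
    IndepFun X Y μ := by
  have := hXY.isProbabilityMeasure
  refine hXY.indepFun_of_covariance_inner fun x y => ?_
  rw [covariance_inner_eq hXY.fst.memLp_two hXY.snd.memLp_two hX0, h1, h2]
  simp

/-- Two jointly Gaussian circularly symmetric variables of unit power and correlation `r`: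
the second one is `r` times the first plus an independent innovation. -/
lemma map_prodMk_eq_of_correlation {A B : Ω → ℂ} {r : ℂ} (hr : ‖r‖ < 1)
    (hAB : HasGaussianLaw (fun ω => (A ω, B ω)) μ)
    (hA0 : ∫ ω, A ω ∂μ = 0) (hB0 : ∫ ω, B ω ∂μ = 0)
    (hAA : ∫ ω, A ω * A ω ∂μ = 0) (hBB : ∫ ω, B ω * B ω ∂μ = 0) (hAB0 : ∫ ω, A ω * B ω ∂μ = 0)
    (hA1 : ∫ ω, A ω * conj (A ω) ∂μ = 1) (hB1 : ∫ ω, B ω * conj (B ω) ∂μ = 1)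
    (hBA : ∫ ω, B ω * conj (A ω) ∂μ = r) :
    μ.map (fun ω => (A ω, B ω)) = (stdComplexGaussian.prod stdComplexGaussian).map
      fun p => (p.1, r * p.1 + √(1 - ‖r‖ ^ 2) * p.2) := by
  have := hAB.isProbabilityMeasure
  have hA := hAB.fst
  have hB := hAB.snd
  have hA2 : MemLp A 2 μ := hA.memLp_two
  have hB2 : MemLp B 2 μ := hB.memLp_two
  have hAi : Integrable A μ := hA2.integrable (by norm_num)
  have hBi : Integrable B μ := hB2.integrable (by norm_num)
  have iAA : Integrable (fun ω => A ω * A ω) μ := hA2.integrable_mul hA2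
  have iAB : Integrable (fun ω => A ω * B ω) μ := hA2.integrable_mul hB2
  have iBB : Integrable (fun ω => B ω * B ω) μ := hB2.integrable_mul hB2
  have jAA : Integrable (fun ω => A ω * conj (A ω)) μ := hA2.integrable_mul hA2.star
  have jAB : Integrable (fun ω => A ω * conj (B ω)) μ := hA2.integrable_mul hB2.star
  have jBA : Integrable (fun ω => B ω * conj (A ω)) μ := hB2.integrable_mul hA2.star
  have jBB : Integrable (fun ω => B ω * conj (B ω)) μ := hB2.integrable_mul hB2.star
  have hAB' : ∫ ω, A ω * conj (B ω) ∂μ = conj r := by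
    rw [← hBA, ← integral_conj]
    simp [mul_comm]
  have hs : 0 < 1 - ‖r‖ ^ 2 := by nlinarith [norm_nonneg r]
  set s : ℝ := √(1 - ‖r‖ ^ 2) with hsdef
  have hs0 : (s : ℂ) ≠ 0 := by simpa using (Real.sqrt_pos.2 hs).ne'
  have hss : (s : ℂ) * s = 1 - r * conj r := by
    rw [← Complex.ofReal_mul, Real.mul_self_sqrt hs.le, Complex.mul_conj']; push_cast; rfl
  -- The residual of `B` after projection onto `A`, rescaled to unit power.
  set W : Ω → ℂ := fun ω => (s : ℂ)⁻¹ * (B ω - r * A ω) with hW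
  have hAW : HasGaussianLaw (fun ω => (A ω, W ω)) μ := by
    let L : ℂ × ℂ →L[ℝ] ℂ × ℂ := (ContinuousLinearMap.fst ℝ ℂ ℂ).prod
      (((s : ℂ)⁻¹ • (ContinuousLinearMap.snd ℂ ℂ ℂ -
        r • ContinuousLinearMap.fst ℂ ℂ ℂ)).restrictScalars ℝ)
    exact hAB.map_fun L
  have hW0 : ∫ ω, W ω ∂μ = 0 := by
    rw [integral_const_mul, integral_sub hBi (hAi.const_mul _), integral_const_mul, hA0, hB0]
    simp
  have hAW0 : ∫ ω, A ω * W ω ∂μ = 0 := by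
    have : ∀ ω, A ω * W ω = (s : ℂ)⁻¹ * (A ω * B ω - r * (A ω * A ω)) := fun ω => by
      simp only [hW]; ring
    simp only [this]
    rw [integral_const_mul, integral_sub iAB (iAA.const_mul _), integral_const_mul, hAA, hAB0]
    simp
  have hAW1 : ∫ ω, A ω * conj (W ω) ∂μ = 0 := by
    have : ∀ ω, A ω * conj (W ω) =
        (s : ℂ)⁻¹ * (A ω * conj (B ω) - conj r * (A ω * conj (A ω))) := fun ω => by
      simp only [hW, map_mul, map_sub, map_inv₀, Complex.conj_ofReal]; ring
    simp only [this]
    rw [integral_const_mul, integral_sub jAB (jAA.const_mul _), integral_const_mul, hA1, hAB']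
    simp
  have hWW0 : ∫ ω, W ω * W ω ∂μ = 0 := by
    have : ∀ ω, W ω * W ω = ((s : ℂ)⁻¹ * (s : ℂ)⁻¹) *
        (B ω * B ω - (2 * r) * (A ω * B ω) + r ^ 2 * (A ω * A ω)) := fun ω => by
      simp only [hW]; ring
    simp only [this]
    have i1 : Integrable (fun ω => B ω * B ω - 2 * r * (A ω * B ω)) μ := iBB.sub (iAB.const_mul _)
    rw [integral_const_mul, integral_add i1 (iAA.const_mul _),
      integral_sub iBB (iAB.const_mul _), integral_const_mul, integral_const_mul, hAA, hAB0, hBB]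
    simp
  have hWW1 : ∫ ω, W ω * conj (W ω) ∂μ = 1 := by
    have : ∀ ω, W ω * conj (W ω) = ((s : ℂ)⁻¹ * (s : ℂ)⁻¹) *
        (B ω * conj (B ω) - r * (A ω * conj (B ω)) -
          (conj r * (B ω * conj (A ω)) - (r * conj r) * (A ω * conj (A ω)))) := fun ω => by
      simp only [hW, map_mul, map_sub, map_inv₀, Complex.conj_ofReal]; ring
    simp only [this]
    have i1 : Integrable (fun ω => B ω * conj (B ω) - r * (A ω * conj (B ω))) μ :=
      jBB.sub (jAB.const_mul _)
    have i2 : Integrable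
        (fun ω => conj r * (B ω * conj (A ω)) - (r * conj r) * (A ω * conj (A ω))) μ :=
      (jBA.const_mul _).sub (jAA.const_mul _)
    rw [integral_const_mul, integral_sub i1 i2,
      integral_sub jBB (jAB.const_mul _), integral_sub (jBA.const_mul _) (jAA.const_mul _),
      integral_const_mul, integral_const_mul, integral_const_mul, hA1, hB1, hBA, hAB',
      ← mul_inv, hss, mul_one, mul_comm (conj r) r, sub_self, sub_zero, ← hss, inv_mul_cancel₀]
    exact mul_ne_zero hs0 hs0
  have hind : IndepFun A W μ := indepFun_of_uncorrelated hAW hA0 hAW0 hAW1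
  have hBW : (fun ω => (A ω, B ω)) =
      (fun p : ℂ × ℂ => (p.1, r * p.1 + s * p.2)) ∘ fun ω => (A ω, W ω) := by
    ext ω
    · rfl
    · simp only [Function.comp, hW]
      field_simp
      ring
  rw [hBW, ← AEMeasurable.map_map_of_aemeasurable (by fun_prop) hAW.aemeasurable,
    (indepFun_iff_map_prod_eq_prod_map_map hA.aemeasurable hAW.snd.aemeasurable).1 hind,
    map_eq_stdComplexGaussian hA hA0 hAA hA1, map_eq_stdComplexGaussian hAW.snd hW0 hWW0 hWW1]

end CircularGaussian

instance : IsProbabilityMeasure stdComplexGaussian := by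
  rw [← map_gaussianReal_prod_eq_stdComplexGaussian]
  exact Measure.isProbabilityMeasure_map (by fun_prop)

/-! ### Incomplete gamma functions and the conditional exceedance probability -/

namespace SISO

lemma upperGamma_natCast_add_one (k : ℕ) (z : ℝ) :
    upperGamma (k + 1) z = ∫ t in Set.Ioi z, t ^ k * Real.exp (-t) := by
  simp [upperGamma]

lemma upperGamma_one (z : ℝ) : upperGamma ((0 : ℕ) + 1) z = Real.exp (-z) := by
  rw [upperGamma_natCast_add_one]
  simpa using integral_exp_neg_Ioi z

lemma upperGamma_nonneg (k : ℕ) {z : ℝ} (hz : 0 ≤ z) : 0 ≤ upperGamma (k + 1) z := by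
  rw [upperGamma_natCast_add_one]
  refine setIntegral_nonneg measurableSet_Ioi fun t ht => ?_
  have : 0 < t := hz.trans_lt ht
  positivity

lemma integrableOn_pow_mul_exp_neg (k : ℕ) {z : ℝ} (hz : 0 ≤ z) :
    IntegrableOn (fun t : ℝ => t ^ k * Real.exp (-t)) (Set.Ioi z) := by
  have h := Real.GammaIntegral_convergent (s := k + 1) (by positivity)
  simp only [add_sub_cancel_right, Real.rpow_natCast] at h
  exact (h.congr_fun (fun t _ => mul_comm _ _) measurableSet_Ioi).mono_set
    (Set.Ioi_subset_Ioi hz)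

/-- The tail of a Gamma law of integer shape and rate `b`. -/
lemma lintegral_indicator_Ici_mul_pow_mul_exp {b x : ℝ} (hb : 0 < b) (hx : 0 ≤ x) (k : ℕ) :
    ∫⁻ u in Set.Ioi 0, (Set.Ici x).indicator 1 u *
        ENNReal.ofReal ((b * u) ^ k * Real.exp (-(b * u)) / k.factorial) =
      ENNReal.ofReal (b⁻¹ * upperGamma (k + 1) (b * x) / k.factorial) := by
  have hset : ∀ u, (Set.Ici x).indicator (1 : ℝ → ℝ≥0∞) u *
        ENNReal.ofReal ((b * u) ^ k * Real.exp (-(b * u)) / k.factorial) =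
      (Set.Ici x).indicator (fun u => ENNReal.ofReal
        ((b * u) ^ k * Real.exp (-(b * u)) / k.factorial)) u := by
    intro u
    by_cases h : u ∈ Set.Ici x <;> simp [h]
  simp only [hset]
  rw [lintegral_indicator measurableSet_Ici, Measure.restrict_restrict measurableSet_Ici]
  have hae : (Set.Ici x ∩ Set.Ioi 0 : Set ℝ) =ᵐ[volume] Set.Ioi x := by
    have h1 : (Set.Ici x ∩ Set.Ioi 0 : Set ℝ) =ᵐ[volume] (Set.Ioi x ∩ Set.Ioi 0 : Set ℝ) :=
      Ioi_ae_eq_Ici.symm.inter (ae_eq_refl _)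
    rwa [Set.Ioi_inter_Ioi, max_eq_left hx] at h1
  rw [Measure.restrict_congr_set hae, ← ofReal_integral_eq_lintegral_ofReal]
  · rw [integral_div, integral_comp_mul_left_Ioi (fun v => v ^ k * Real.exp (-v)) x hb,
      upperGamma_natCast_add_one, smul_eq_mul]
  · refine Integrable.div_const ?_ _
    exact (integrableOn_Ioi_comp_mul_left_iff (fun v : ℝ => v ^ k * Real.exp (-v)) x hb).2
      (integrableOn_pow_mul_exp_neg k (by positivity))
  · filter_upwards [ae_restrict_mem measurableSet_Ioi] with u hu
    have : 0 < u := hx.trans_lt hu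
    positivity

/-- With `c = 0` the Poisson mixture collapses to `k = 0`, leaving the exponential law. -/
lemma lintegral_norm_sq_stdComplexGaussian {f : ℝ → ℝ≥0∞} (hf : Measurable f) :
    ∫⁻ z, f (‖z‖ ^ 2) ∂stdComplexGaussian =
      ∫⁻ u in Set.Ioi 0, f u * ENNReal.ofReal (Real.exp (-u)) := by
  have h := lintegral_norm_sq_add_stdComplexGaussian 0 hf
  simp only [zero_add] at h
  rw [h]
  refine lintegral_congr fun u => ?_
  rw [tsum_eq_single 0 (fun k hk => by simp [hk])]
  simp

/-- The conditional probability that the second squared envelope is at least `x`, given that the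
first one is `t`, for two samples whose correlation has modulus `ϱ`. -/
noncomputable def exceedanceKernel (ϱ x t : ℝ) : ℝ≥0∞ :=
  ∑' k : ℕ, ENNReal.ofReal (Real.exp (-(ϱ ^ 2 * t / (1 - ϱ ^ 2))) *
      (ϱ ^ 2 * t / (1 - ϱ ^ 2)) ^ k / k.factorial) *
    ENNReal.ofReal (upperGamma (k + 1) (x / (1 - ϱ ^ 2)) / k.factorial)

lemma measurable_exceedanceKernel (ϱ x : ℝ) : Measurable (exceedanceKernel ϱ x) := by
  unfold exceedanceKernel
  fun_prop

/-- The `k = 0` term is a product of two exponentials. -/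
lemma exceedanceKernel_pos (ϱ x t : ℝ) : 0 < exceedanceKernel ϱ x t := by
  refine lt_of_lt_of_le ?_ (ENNReal.le_tsum 0)
  rw [upperGamma_one]
  refine ENNReal.mul_pos ?_ ?_ <;>
  · rw [ENNReal.ofReal_ne_zero_iff]
    simp
    try positivity

/-- Factoring `r z + s w = s (r z / s + w)` rescales the threshold to `x / (1 - ‖r‖²)` and makes `‖r
z / s‖²` the Poisson mean. -/
lemma lintegral_indicator_innovation {r : ℂ} (hr : ‖r‖ < 1) {x : ℝ} (hx : 0 ≤ x) (z : ℂ) :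
    ∫⁻ w, (Set.Ici x).indicator 1 (‖r * z + √(1 - ‖r‖ ^ 2) * w‖ ^ 2) ∂stdComplexGaussian =
      exceedanceKernel ‖r‖ x (‖z‖ ^ 2) := by
  have hs : 0 < 1 - ‖r‖ ^ 2 := by nlinarith [norm_nonneg r]
  set s : ℝ := √(1 - ‖r‖ ^ 2) with hsdef
  have hss : s ^ 2 = 1 - ‖r‖ ^ 2 := Real.sq_sqrt hs.le
  have hs0 : (s : ℂ) ≠ 0 := by simpa using (Real.sqrt_pos.2 hs).ne'
  have hpt : ∀ w : ℂ, (Set.Ici x).indicator (1 : ℝ → ℝ≥0∞) (‖r * z + s * w‖ ^ 2) =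
      (Set.Ici (x / (1 - ‖r‖ ^ 2))).indicator 1 (‖r * z / s + w‖ ^ 2) := by
    intro w
    have : r * z + s * w = s * (r * z / s + w) := by field_simp
    rw [this, norm_mul, mul_pow, Complex.norm_real, Real.norm_eq_abs, sq_abs, hss]
    refine Set.indicator_eq_indicator ?_ rfl
    rw [Set.mem_Ici, Set.mem_Ici, div_le_iff₀' hs]
  simp only [hpt]
  rw [lintegral_norm_sq_add_stdComplexGaussian _ (measurable_one.indicator measurableSet_Ici),
    lintegral_tsum (fun k => by
      have := (measurable_one (α := ℝ≥0∞)).indicator (measurableSet_Ici (a := x / (1 - ‖r‖ ^ 2)))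
      fun_prop)]
  refine tsum_congr fun k => ?_
  simp only [mul_left_comm _ (ENNReal.ofReal (Real.exp _ * _ / _))]
  have hc : ‖r * z / s‖ ^ 2 = ‖r‖ ^ 2 * ‖z‖ ^ 2 / (1 - ‖r‖ ^ 2) := by
    rw [norm_div, norm_mul, div_pow, mul_pow, Complex.norm_real, Real.norm_eq_abs, sq_abs, hss]
  rw [lintegral_const_mul _ (by
    have := (measurable_one (α := ℝ≥0∞)).indicator (measurableSet_Ici (a := x / (1 - ‖r‖ ^ 2)))
    fun_prop), hc]
  congr 1
  have h := lintegral_indicator_Ici_mul_pow_mul_exp one_pos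
    (div_nonneg hx hs.le : 0 ≤ x / (1 - ‖r‖ ^ 2)) k
  simpa using h

lemma lintegral_norm_sq_mul_indicator {r : ℂ} (hr : ‖r‖ < 1) {x : ℝ} (hx : 0 ≤ x)
    {f : ℝ → ℝ≥0∞} (hf : Measurable f) :
    ∫⁻ p, f (‖p.1‖ ^ 2) * (Set.Ici x).indicator 1 (‖p.2‖ ^ 2)
        ∂(stdComplexGaussian.prod stdComplexGaussian).map
          (fun p : ℂ × ℂ => (p.1, r * p.1 + √(1 - ‖r‖ ^ 2) * p.2)) =
      ∫⁻ u in Set.Ioi 0, f u * exceedanceKernel ‖r‖ x u * ENNReal.ofReal (Real.exp (-u)) := by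
  have hi : Measurable ((Set.Ici x).indicator (1 : ℝ → ℝ≥0∞)) :=
    measurable_one.indicator measurableSet_Ici
  have hK := measurable_exceedanceKernel ‖r‖ x
  rw [lintegral_map (by fun_prop) (by fun_prop), lintegral_prod _ (by fun_prop),
    ← lintegral_norm_sq_stdComplexGaussian (f := fun u => f u * exceedanceKernel ‖r‖ x u)
      (by fun_prop)]
  refine lintegral_congr fun z => ?_
  simp only
  rw [lintegral_const_mul _ (by fun_prop), lintegral_indicator_innovation hr hx]

/-- The Poisson factor `e^{-ϱ² u/(1-ϱ²)}` times `e^{-u}` is `e^{-u/(1-ϱ²)}`, so each term integrates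
to a Gamma tail of rate `1/(1-ϱ²)`. That tail repeats the kernel's incomplete gamma value, and the
inverse rate is the prefactor `1 - ϱ²`. -/
lemma lintegral_indicator_mul_exceedanceKernel {ϱ x : ℝ} (h0 : 0 ≤ ϱ) (h1 : ϱ < 1) (hx : 0 ≤ x) :
    ∫⁻ u in Set.Ioi 0, (Set.Ici x).indicator 1 u * exceedanceKernel ϱ x u *
        ENNReal.ofReal (Real.exp (-u)) =
      ∑' k : ℕ, ENNReal.ofReal ((1 - ϱ ^ 2) * (ϱ ^ k / (k.factorial : ℝ) *
        upperGamma ((k : ℝ) + 1) (x / (1 - ϱ ^ 2))) ^ 2) := by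
  have hs : 0 < 1 - ϱ ^ 2 := by nlinarith
  have hi : Measurable ((Set.Ici x).indicator (1 : ℝ → ℝ≥0∞)) :=
    measurable_one.indicator measurableSet_Ici
  have hΓ (k : ℕ) : 0 ≤ upperGamma (k + 1) (x / (1 - ϱ ^ 2)) :=
    upperGamma_nonneg k (div_nonneg hx hs.le)
  have hpt : ∀ u ∈ Set.Ioi (0 : ℝ), (Set.Ici x).indicator 1 u * exceedanceKernel ϱ x u *
        ENNReal.ofReal (Real.exp (-u)) =
      ∑' k : ℕ, ENNReal.ofReal ((ϱ ^ 2) ^ k * upperGamma (k + 1) (x / (1 - ϱ ^ 2)) / k.factorial) *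
        ((Set.Ici x).indicator 1 u * ENNReal.ofReal (((1 - ϱ ^ 2)⁻¹ * u) ^ k *
          Real.exp (-((1 - ϱ ^ 2)⁻¹ * u)) / k.factorial)) := by
    intro u hu
    have hu : 0 < u := hu
    rw [exceedanceKernel, mul_assoc, ← ENNReal.tsum_mul_right, ← ENNReal.tsum_mul_left]
    refine tsum_congr fun k => ?_
    rw [mul_left_comm (ENNReal.ofReal _) (Set.indicator _ _ _)]
    congr 1
    have := hΓ k
    rw [← ENNReal.ofReal_mul (by positivity), ← ENNReal.ofReal_mul (by positivity),
      ← ENNReal.ofReal_mul (by positivity)]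
    congr 1
    have he : Real.exp (-((1 - ϱ ^ 2)⁻¹ * u)) =
        Real.exp (-(ϱ ^ 2 * u / (1 - ϱ ^ 2))) * Real.exp (-u) := by
      rw [← Real.exp_add]
      congr 1
      field_simp
      ring
    rw [he, show ϱ ^ 2 * u / (1 - ϱ ^ 2) = ϱ ^ 2 * ((1 - ϱ ^ 2)⁻¹ * u) by ring, mul_pow]
    ring
  rw [setLIntegral_congr_fun measurableSet_Ioi hpt, lintegral_tsum (fun k => by fun_prop)]
  refine tsum_congr fun k => ?_
  have := hΓ k
  rw [lintegral_const_mul _ (by fun_prop),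
    lintegral_indicator_Ici_mul_pow_mul_exp (inv_pos.2 hs) hx, inv_inv,
    ← ENNReal.ofReal_mul (by positivity), inv_mul_eq_div]
  congr 1
  ring

lemma lintegral_indicator_Iio_mul_exceedanceKernel_pos (ϱ : ℝ) {x : ℝ} (hx : 0 < x) :
    0 < ∫⁻ u in Set.Ioi 0, (Set.Iio x).indicator 1 u * exceedanceKernel ϱ x u *
        ENNReal.ofReal (Real.exp (-u)) := by
  have hi : Measurable ((Set.Iio x).indicator (1 : ℝ → ℝ≥0∞)) :=
    measurable_one.indicator measurableSet_Iio
  have hK := measurable_exceedanceKernel ϱ x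
  rw [setLIntegral_pos_iff (by fun_prop)]
  refine lt_of_lt_of_le ?_ (measure_mono (s := Set.Ioo 0 x) fun u hu => ⟨?_, hu.1⟩)
  · simpa using hx
  · have h1 := (exceedanceKernel_pos ϱ x u).ne'
    simp [hu.2, h1, Real.exp_pos]

/-! ### One- and two-sample envelope probabilities -/

section Samples

variable {Ω : Type*} [MeasurableSpace Ω] {μ : Measure Ω} {A B : Ω → ℂ} {r : ℂ}

lemma measure_norm_sq_mem (hA : AEMeasurable A μ) (hmap : μ.map A = stdComplexGaussian)
    {S : Set ℝ} (hS : MeasurableSet S) :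
    μ {ω | ‖A ω‖ ^ 2 ∈ S} =
      ∫⁻ u in Set.Ioi 0, S.indicator 1 u * ENNReal.ofReal (Real.exp (-u)) := by
  have hS' : MeasurableSet {z : ℂ | ‖z‖ ^ 2 ∈ S} :=
    (by fun_prop : Measurable fun z : ℂ => ‖z‖ ^ 2) hS
  have h : μ {ω | ‖A ω‖ ^ 2 ∈ S} = μ.map A {z : ℂ | ‖z‖ ^ 2 ∈ S} :=
    (Measure.map_apply_of_aemeasurable hA hS').symm
  rw [h, hmap, ← lintegral_indicator_one hS',
    ← lintegral_norm_sq_stdComplexGaussian (measurable_one.indicator hS)]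
  rfl

lemma measure_norm_sq_ge (hA : AEMeasurable A μ) (hmap : μ.map A = stdComplexGaussian) {x : ℝ}
    (hx : 0 ≤ x) : μ {ω | x ≤ ‖A ω‖ ^ 2} = ENNReal.ofReal (Real.exp (-x)) := by
  have h := lintegral_indicator_Ici_mul_pow_mul_exp one_pos hx 0
  simp only [upperGamma_one] at h
  refine (measure_norm_sq_mem hA hmap measurableSet_Ici).trans ?_
  simpa using h

/-- The exponential law has no atoms; the strict form is the complement needed for the distribution
function. -/
lemma measure_norm_sq_gt (hA : AEMeasurable A μ) (hmap : μ.map A = stdComplexGaussian) {x : ℝ}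
    (hx : 0 ≤ x) : μ {ω | x < ‖A ω‖ ^ 2} = ENNReal.ofReal (Real.exp (-x)) := by
  refine Eq.trans ?_ (measure_norm_sq_ge hA hmap hx)
  refine (measure_norm_sq_mem hA hmap measurableSet_Ioi).trans
    (Eq.trans ?_ (measure_norm_sq_mem hA hmap measurableSet_Ici).symm)
  refine lintegral_congr_ae ?_
  have h : (Set.Ioi x).indicator (1 : ℝ → ℝ≥0∞) =ᵐ[volume.restrict (Set.Ioi 0)]
      (Set.Ici x).indicator 1 :=
    ae_restrict_of_ae (indicator_ae_eq_of_ae_eq_set Ioi_ae_eq_Ici)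
  filter_upwards [h] with u hu
  rw [hu]

lemma measureReal_norm_sq_le [IsProbabilityMeasure μ] (hA : AEMeasurable A μ)
    (hmap : μ.map A = stdComplexGaussian) {x : ℝ} (hx : 0 ≤ x) :
    μ.real {ω | ‖A ω‖ ^ 2 ≤ x} = 1 - Real.exp (-x) := by
  have hS : NullMeasurableSet {ω | x < ‖A ω‖ ^ 2} μ :=
    nullMeasurableSet_lt aemeasurable_const (hA.norm.pow_const 2)
  have h := measureReal_add_measureReal_compl₀ hS
  rw [probReal_univ] at h
  have hc : {ω | x < ‖A ω‖ ^ 2}ᶜ = {ω | ‖A ω‖ ^ 2 ≤ x} := by ext; simp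
  rw [hc, measureReal_def, measure_norm_sq_gt hA hmap hx,
    ENNReal.toReal_ofReal (Real.exp_pos _).le] at h
  linarith

lemma measure_norm_sq_mem_and_ge (hr : ‖r‖ < 1) (hAB : AEMeasurable (fun ω => (A ω, B ω)) μ)
    (hmap : μ.map (fun ω => (A ω, B ω)) = (stdComplexGaussian.prod stdComplexGaussian).map
      fun p => (p.1, r * p.1 + √(1 - ‖r‖ ^ 2) * p.2))
    {x : ℝ} (hx : 0 ≤ x) {S : Set ℝ} (hS : MeasurableSet S) :
    μ {ω | ‖A ω‖ ^ 2 ∈ S ∧ x ≤ ‖B ω‖ ^ 2} =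
      ∫⁻ u in Set.Ioi 0, S.indicator 1 u * exceedanceKernel ‖r‖ x u *
        ENNReal.ofReal (Real.exp (-u)) := by
  have h2 : MeasurableSet {p : ℂ × ℂ | x ≤ ‖p.2‖ ^ 2} :=
    measurableSet_le (by fun_prop) (by fun_prop)
  have hS' : MeasurableSet {p : ℂ × ℂ | ‖p.1‖ ^ 2 ∈ S ∧ x ≤ ‖p.2‖ ^ 2} :=
    ((by fun_prop : Measurable fun p : ℂ × ℂ => ‖p.1‖ ^ 2) hS).inter h2
  have h : μ {ω | ‖A ω‖ ^ 2 ∈ S ∧ x ≤ ‖B ω‖ ^ 2} =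
      μ.map (fun ω => (A ω, B ω)) {p : ℂ × ℂ | ‖p.1‖ ^ 2 ∈ S ∧ x ≤ ‖p.2‖ ^ 2} :=
    (Measure.map_apply_of_aemeasurable hAB hS').symm
  rw [h, hmap, ← lintegral_norm_sq_mul_indicator hr hx (measurable_one.indicator hS),
    ← lintegral_indicator_one hS']
  refine lintegral_congr fun p => ?_
  by_cases h1 : ‖p.1‖ ^ 2 ∈ S <;> by_cases h2 : x ≤ ‖p.2‖ ^ 2 <;> simp [h1, h2]

/-- The bivariate Rayleigh tail as a series of incomplete gamma functions. -/
lemma hasSum_measureReal_norm_sq_ge_and_ge [IsFiniteMeasure μ] (hr : ‖r‖ < 1)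
    (hAB : AEMeasurable (fun ω => (A ω, B ω)) μ)
    (hmap : μ.map (fun ω => (A ω, B ω)) = (stdComplexGaussian.prod stdComplexGaussian).map
      fun p => (p.1, r * p.1 + √(1 - ‖r‖ ^ 2) * p.2))
    {x : ℝ} (hx : 0 ≤ x) :
    HasSum (fun k : ℕ => (1 - ‖r‖ ^ 2) * (‖r‖ ^ k / (k.factorial : ℝ) *
        upperGamma ((k : ℝ) + 1) (x / (1 - ‖r‖ ^ 2))) ^ 2)
      (μ.real {ω | x ≤ ‖A ω‖ ^ 2 ∧ x ≤ ‖B ω‖ ^ 2}) := by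
  have hs : 0 < 1 - ‖r‖ ^ 2 := by nlinarith [norm_nonneg r]
  have h : μ {ω | x ≤ ‖A ω‖ ^ 2 ∧ x ≤ ‖B ω‖ ^ 2} = _ :=
    (measure_norm_sq_mem_and_ge hr hAB hmap hx measurableSet_Ici).trans
      (lintegral_indicator_mul_exceedanceKernel (norm_nonneg r) hr hx)
  -- Finiteness of the measure is what makes the real series converge.
  have htop := h ▸ measure_ne_top μ {ω | x ≤ ‖A ω‖ ^ 2 ∧ x ≤ ‖B ω‖ ^ 2}
  have hsum := ENNReal.hasSum_toReal htop
  rw [measureReal_def, h, ENNReal.tsum_toReal_eq fun k => ENNReal.ofReal_ne_top]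
  convert hsum using 2 with k
  rw [ENNReal.toReal_ofReal (by positivity)]

lemma measureReal_norm_sq_lt_and_ge_pos [IsFiniteMeasure μ] (hr : ‖r‖ < 1)
    (hAB : AEMeasurable (fun ω => (A ω, B ω)) μ)
    (hmap : μ.map (fun ω => (A ω, B ω)) = (stdComplexGaussian.prod stdComplexGaussian).map
      fun p => (p.1, r * p.1 + √(1 - ‖r‖ ^ 2) * p.2))
    {x : ℝ} (hx : 0 < x) :
    0 < μ.real {ω | ‖A ω‖ ^ 2 < x ∧ x ≤ ‖B ω‖ ^ 2} := by
  refine ENNReal.toReal_pos (LT.lt.ne' ?_) (measure_ne_top μ _)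
  exact (lintegral_indicator_Iio_mul_exceedanceKernel_pos ‖r‖ hx).trans_eq
    (measure_norm_sq_mem_and_ge hr hAB hmap hx.le measurableSet_Iio).symm

end Samples

/-! ### Crossing counts as polynomials in the binary sequence -/

section Deterministic

variable {Ω : Type*} {h : ℝ → Ω → ℂ} {Ts η Ith : ℝ} {l L : ℕ} {ω : Ω}

lemma le_imi_iff (hη : 0 < η) :
    Ith ≤ imi h Ts η l ω ↔ (2 ^ Ith - 1) / η ≤ ‖h (l * Ts) ω‖ ^ 2 := by
  rw [imi, envelope, Real.le_logb_iff_rpow_le one_lt_two (by positivity), div_le_iff₀' hη,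
    sub_le_iff_le_add']

lemma imi_le_iff (hη : 0 < η) :
    imi h Ts η l ω ≤ Ith ↔ ‖h (l * Ts) ω‖ ^ 2 ≤ (2 ^ Ith - 1) / η := by
  rw [imi, envelope, Real.logb_le_iff_le_rpow one_lt_two (by positivity), le_div_iff₀' hη,
    le_sub_iff_add_le']

lemma binary_eq_one_iff (hη : 0 < η) :
    binary h Ts η Ith l ω = 1 ↔ (2 ^ Ith - 1) / η ≤ ‖h (l * Ts) ω‖ ^ 2 := by
  simp [binary, le_imi_iff hη]

lemma binary_eq_indicator (hη : 0 < η) :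
    binary h Ts η Ith l = {ω | (2 ^ Ith - 1) / η ≤ ‖h (l * Ts) ω‖ ^ 2}.indicator 1 := by
  ext ω
  by_cases hc : (2 ^ Ith - 1) / η ≤ ‖h (l * Ts) ω‖ ^ 2 <;> simp [binary, le_imi_iff hη, hc]

lemma binary_mul_binary_eq_indicator (hη : 0 < η) (j l : ℕ) :
    (fun ω => binary h Ts η Ith j ω * binary h Ts η Ith l ω) =
      ({ω | (2 ^ Ith - 1) / η ≤ ‖h (l * Ts) ω‖ ^ 2} ∩
        {ω | (2 ^ Ith - 1) / η ≤ ‖h (j * Ts) ω‖ ^ 2}).indicator 1 := by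
  rw [binary_eq_indicator hη, binary_eq_indicator hη, Set.inter_comm, Set.inter_indicator_one]
  rfl

/-- Since `X² = X` for binary values, the squared difference needs only single and pairwise
expectations. -/
lemma crossings_eq_sum :
    crossings h Ts η Ith L ω = ∑ l ∈ Finset.Icc 2 L, (binary h Ts η Ith l ω +
      binary h Ts η Ith (l - 1) ω - 2 * (binary h Ts η Ith (l - 1) ω * binary h Ts η Ith l ω)) := by
  refine Finset.sum_congr rfl fun l _ => ?_
  unfold binary
  split_ifs <;> norm_num

lemma downCrossings_eq_sum :
    (downCrossings h Ts η Ith L ω : ℝ) = ∑ l ∈ Finset.Icc 2 L, (binary h Ts η Ith (l - 1) ω -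
      binary h Ts η Ith (l - 1) ω * binary h Ts η Ith l ω) := by
  rw [downCrossings, Finset.card_filter, Nat.cast_sum]
  refine Finset.sum_congr rfl fun l _ => ?_
  unfold binary
  split_ifs <;> simp_all

lemma outageTime_eq_sum :
    outageTime h Ts η Ith L ω = Ts * ∑ l ∈ Finset.Icc 2 L, (1 - binary h Ts η Ith l ω) := by
  rw [outageTime, Finset.card_filter, Nat.cast_sum]
  congr 1
  refine Finset.sum_congr rfl fun l _ => ?_
  simp only [binary, ← not_le]
  split_ifs <;> simp_all

end Deterministic

/-! ### Expectations for the Rayleigh channel -/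

section Channel

variable {Ω : Type*} [MeasurableSpace Ω] {μ : Measure Ω} {h : ℝ → Ω → ℂ} {ρ : ℝ → ℂ}

lemma IsRayleighChannel.integral_mul_conj_self (hh : IsRayleighChannel μ h ρ) (t : ℝ) :
    ∫ ω, h t ω * conj (h t ω) ∂μ = 1 := by
  have := hh.correlation t 0
  rwa [sub_zero, hh.unit_power] at this

lemma IsRayleighChannel.map_eq (hh : IsRayleighChannel μ h ρ) (t : ℝ) :
    μ.map (h t) = stdComplexGaussian :=
  map_eq_stdComplexGaussian (hh.gaussian.hasGaussianLaw_eval t) (hh.zero_mean t) (hh.circular t t)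
    (hh.integral_mul_conj_self t)

lemma IsRayleighChannel.map_prodMk_eq (hh : IsRayleighChannel μ h ρ) (s τ : ℝ) (hρ : ‖ρ τ‖ < 1) :
    μ.map (fun ω => (h s ω, h (s + τ) ω)) = (stdComplexGaussian.prod stdComplexGaussian).map
      fun p => (p.1, ρ τ * p.1 + √(1 - ‖ρ τ‖ ^ 2) * p.2) := by
  have hcorr := hh.correlation (s + τ) τ
  rw [add_sub_cancel_right] at hcorr
  exact map_prodMk_eq_of_correlation hρ hh.gaussian.hasGaussianLaw_prodMk (hh.zero_mean _)
    (hh.zero_mean _) (hh.circular _ _) (hh.circular _ _) (hh.circular _ _)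
    (hh.integral_mul_conj_self _) (hh.integral_mul_conj_self _) hcorr

lemma natCast_sub_one_mul_add (Ts : ℝ) {l : ℕ} (hl : 1 ≤ l) :
    ((l - 1 : ℕ) : ℝ) * Ts + Ts = l * Ts := by
  rw [Nat.cast_sub hl]; push_cast; ring

variable {Ts η Ith : ℝ}

lemma IsRayleighChannel.nullMeasurableSet_ge (hh : IsRayleighChannel μ h ρ) (x t : ℝ) :
    NullMeasurableSet {ω | x ≤ ‖h t ω‖ ^ 2} μ :=
  nullMeasurableSet_le aemeasurable_const ((hh.gaussian.aemeasurable t).norm.pow_const 2)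

/-- The probability that two consecutive samples are both above the threshold. -/
noncomputable def jointExceedance (ϱ η Ith : ℝ) : ℝ :=
  (1 - ϱ ^ 2) * ∑' k : ℕ, (ϱ ^ k / (k.factorial : ℝ) *
    upperGamma ((k : ℝ) + 1) ((2 ^ Ith - 1) / (η * (1 - ϱ ^ 2)))) ^ 2

lemma threshold_nonneg (hη : 0 < η) (hI : 0 ≤ Ith) : 0 ≤ ((2 : ℝ) ^ Ith - 1) / η :=
  div_nonneg (sub_nonneg.2 (Real.one_le_rpow one_le_two hI)) hη.le

lemma threshold_pos (hη : 0 < η) (hI : 0 < Ith) : 0 < ((2 : ℝ) ^ Ith - 1) / η :=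
  div_pos (sub_pos.2 (Real.one_lt_rpow one_lt_two hI)) hη

lemma IsRayleighChannel.measureReal_binary (hh : IsRayleighChannel μ h ρ) (hη : 0 < η)
    (hI : 0 ≤ Ith) (l : ℕ) :
    μ.real {ω | binary h Ts η Ith l ω = 1} = Real.exp (-((2 ^ Ith - 1) / η)) := by
  simp only [binary_eq_one_iff hη]
  rw [measureReal_def, measure_norm_sq_ge (hh.gaussian.aemeasurable _) (hh.map_eq _)
    (threshold_nonneg hη hI), ENNReal.toReal_ofReal (Real.exp_pos _).le]

lemma IsRayleighChannel.integral_binary (hh : IsRayleighChannel μ h ρ) (hη : 0 < η)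
    (hI : 0 ≤ Ith) (l : ℕ) :
    ∫ ω, binary h Ts η Ith l ω ∂μ = Real.exp (-((2 ^ Ith - 1) / η)) := by
  rw [← hh.measureReal_binary (Ts := Ts) hη hI l]
  simp only [binary_eq_one_iff hη]
  rw [binary_eq_indicator hη, integral_indicator₀ (hh.nullMeasurableSet_ge _ _)]
  simp

variable [IsProbabilityMeasure μ]

lemma IsRayleighChannel.hasSum_joint (hh : IsRayleighChannel μ h ρ) (hη : 0 < η)
    (hI : 0 ≤ Ith) (hρ : ‖ρ Ts‖ < 1) {l : ℕ} (hl : 1 ≤ l) :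
    HasSum (fun k : ℕ => (1 - ‖ρ Ts‖ ^ 2) * (‖ρ Ts‖ ^ k / (k.factorial : ℝ) *
        upperGamma ((k : ℝ) + 1) ((2 ^ Ith - 1) / (η * (1 - ‖ρ Ts‖ ^ 2)))) ^ 2)
      (μ.real {ω | binary h Ts η Ith l ω = 1 ∧ binary h Ts η Ith (l - 1) ω = 1}) := by
  have hAB := (hh.gaussian.hasGaussianLaw_prodMk (s := ((l - 1 : ℕ) : ℝ) * Ts)
    (t := ((l - 1 : ℕ) : ℝ) * Ts + Ts)).aemeasurable
  have key := hasSum_measureReal_norm_sq_ge_and_ge hρ hAB (hh.map_prodMk_eq _ _ hρ)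
    (threshold_nonneg hη hI)
  simp only [binary_eq_one_iff hη, and_comm (a := _ ≤ ‖h (l * Ts) _‖ ^ 2)]
  simpa only [natCast_sub_one_mul_add Ts hl, div_div] using key

lemma IsRayleighChannel.measureReal_joint (hh : IsRayleighChannel μ h ρ) (hη : 0 < η)
    (hI : 0 ≤ Ith) (hρ : ‖ρ Ts‖ < 1) {l : ℕ} (hl : 1 ≤ l) :
    μ.real {ω | binary h Ts η Ith l ω = 1 ∧ binary h Ts η Ith (l - 1) ω = 1} =
      jointExceedance ‖ρ Ts‖ η Ith := by
  rw [← (hh.hasSum_joint hη hI hρ hl).tsum_eq, tsum_mul_left, jointExceedance]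

/-- The gap is the probability of an up-crossing, positive by `measureReal_norm_sq_lt_and_ge_pos`.
Neither side depends on the index, so samples `0` and `1` serve. -/
lemma IsRayleighChannel.jointExceedance_lt (hh : IsRayleighChannel μ h ρ) (hη : 0 < η)
    (hI : 0 < Ith) (hρ : ‖ρ Ts‖ < 1) :
    jointExceedance ‖ρ Ts‖ η Ith < Real.exp (-((2 ^ Ith - 1) / η)) := by
  have hAB := (hh.gaussian.hasGaussianLaw_prodMk (s := ((1 - 1 : ℕ) : ℝ) * Ts)
    (t := ((1 - 1 : ℕ) : ℝ) * Ts + Ts)).aemeasurable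
  have hpos := measureReal_norm_sq_lt_and_ge_pos hρ hAB (hh.map_prodMk_eq _ _ hρ)
    (threshold_pos hη hI)
  rw [natCast_sub_one_mul_add Ts le_rfl] at hpos
  rw [← hh.measureReal_joint hη hI.le hρ le_rfl, ← hh.measureReal_binary (Ts := Ts) hη hI.le 1]
  simp only [binary_eq_one_iff hη]
  set x : ℝ := (2 ^ Ith - 1) / η
  have hsplit := measureReal_inter_add_sdiff₀ (μ := μ)
    (s := {ω | x ≤ ‖h ((1 : ℕ) * Ts) ω‖ ^ 2})
    (hh.nullMeasurableSet_ge x (((1 - 1 : ℕ) : ℝ) * Ts))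
  have hdiff : {ω | x ≤ ‖h ((1 : ℕ) * Ts) ω‖ ^ 2} \ {ω | x ≤ ‖h (((1 - 1 : ℕ) : ℝ) * Ts) ω‖ ^ 2} =
      {ω | ‖h (((1 - 1 : ℕ) : ℝ) * Ts) ω‖ ^ 2 < x ∧ x ≤ ‖h ((1 : ℕ) * Ts) ω‖ ^ 2} := by
    ext ω; simp [and_comm]
  rw [hdiff] at hsplit
  rw [← hsplit]
  exact lt_add_of_pos_right _ hpos

lemma IsRayleighChannel.integrable_binary (hh : IsRayleighChannel μ h ρ) (hη : 0 < η) (l : ℕ) :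
    Integrable (binary h Ts η Ith l) μ := by
  rw [binary_eq_indicator hη]
  exact (integrable_const 1).indicator₀ (hh.nullMeasurableSet_ge _ _)

lemma IsRayleighChannel.integrable_binary_mul (hh : IsRayleighChannel μ h ρ) (hη : 0 < η)
    (j l : ℕ) : Integrable (fun ω => binary h Ts η Ith j ω * binary h Ts η Ith l ω) μ := by
  rw [binary_mul_binary_eq_indicator hη]
  exact (integrable_const 1).indicator₀ ((hh.nullMeasurableSet_ge _ _).inter
    (hh.nullMeasurableSet_ge _ _))

lemma IsRayleighChannel.integral_binary_mul (hh : IsRayleighChannel μ h ρ) (hη : 0 < η)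
    (hI : 0 ≤ Ith) (hρ : ‖ρ Ts‖ < 1) {l : ℕ} (hl : 1 ≤ l) :
    ∫ ω, binary h Ts η Ith (l - 1) ω * binary h Ts η Ith l ω ∂μ =
      jointExceedance ‖ρ Ts‖ η Ith := by
  rw [← hh.measureReal_joint hη hI hρ hl]
  simp only [binary_eq_one_iff hη]
  rw [binary_mul_binary_eq_indicator hη, integral_indicator₀ ((hh.nullMeasurableSet_ge _ _).inter
    (hh.nullMeasurableSet_ge _ _))]
  simp only [Pi.one_apply, integral_const, smul_eq_mul, mul_one]
  rw [measureReal_restrict_apply_univ]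
  rfl

lemma sum_Icc_two_const {L : ℕ} (hL : 2 ≤ L) (c : ℝ) :
    ∑ _l ∈ Finset.Icc 2 L, c = ((L : ℝ) - 1) * c := by
  rw [Finset.sum_const, Nat.card_Icc, nsmul_eq_mul, Nat.add_sub_add_right L 1 1,
    Nat.cast_sub (by omega), Nat.cast_one]

lemma IsRayleighChannel.integral_downCrossings (hh : IsRayleighChannel μ h ρ) (hη : 0 < η)
    (hI : 0 ≤ Ith) (hρ : ‖ρ Ts‖ < 1) {L : ℕ} (hL : 2 ≤ L) :
    ∫ ω, (downCrossings h Ts η Ith L ω : ℝ) ∂μ =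
      ((L : ℝ) - 1) * (Real.exp (-((2 ^ Ith - 1) / η)) - jointExceedance ‖ρ Ts‖ η Ith) := by
  simp only [downCrossings_eq_sum]
  have i (l : ℕ) : Integrable (fun ω => binary h Ts η Ith (l - 1) ω -
      binary h Ts η Ith (l - 1) ω * binary h Ts η Ith l ω) μ :=
    (hh.integrable_binary hη _).sub (hh.integrable_binary_mul hη _ _)
  rw [integral_finsetSum _ fun l _ => i l, ← sum_Icc_two_const hL]
  refine Finset.sum_congr rfl fun l hl => ?_
  rw [integral_sub (hh.integrable_binary hη _) (hh.integrable_binary_mul hη _ _),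
    hh.integral_binary hη hI, hh.integral_binary_mul hη hI hρ
      (one_le_two.trans (Finset.mem_Icc.1 hl).1)]

lemma IsRayleighChannel.integral_crossings (hh : IsRayleighChannel μ h ρ) (hη : 0 < η)
    (hI : 0 ≤ Ith) (hρ : ‖ρ Ts‖ < 1) {L : ℕ} (hL : 2 ≤ L) :
    ∫ ω, crossings h Ts η Ith L ω ∂μ =
      ((L : ℝ) - 1) * (2 * (Real.exp (-((2 ^ Ith - 1) / η)) - jointExceedance ‖ρ Ts‖ η Ith)) := by
  simp only [crossings_eq_sum]
  have i1 (l : ℕ) : Integrable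
      (fun ω => binary h Ts η Ith l ω + binary h Ts η Ith (l - 1) ω) μ :=
    (hh.integrable_binary hη _).add (hh.integrable_binary hη _)
  have i2 (l : ℕ) : Integrable
      (fun ω => 2 * (binary h Ts η Ith (l - 1) ω * binary h Ts η Ith l ω)) μ :=
    (hh.integrable_binary_mul hη _ _).const_mul 2
  have i (l : ℕ) : Integrable (fun ω => binary h Ts η Ith l ω + binary h Ts η Ith (l - 1) ω -
      2 * (binary h Ts η Ith (l - 1) ω * binary h Ts η Ith l ω)) μ := (i1 l).sub (i2 l)
  rw [integral_finsetSum _ fun l _ => i l, ← sum_Icc_two_const hL]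
  refine Finset.sum_congr rfl fun l hl => ?_
  rw [integral_sub (i1 l) (i2 l), integral_add (hh.integrable_binary hη _)
    (hh.integrable_binary hη _), integral_const_mul,
    hh.integral_binary hη hI, hh.integral_binary hη hI, hh.integral_binary_mul hη hI hρ
      (one_le_two.trans (Finset.mem_Icc.1 hl).1)]
  ring

lemma IsRayleighChannel.integral_outageTime (hh : IsRayleighChannel μ h ρ) (hη : 0 < η)
    (hI : 0 ≤ Ith) {L : ℕ} (hL : 2 ≤ L) :
    ∫ ω, outageTime h Ts η Ith L ω ∂μ =
      Ts * (((L : ℝ) - 1) * (1 - Real.exp (-((2 ^ Ith - 1) / η)))) := by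
  simp only [outageTime_eq_sum]
  have i (l : ℕ) : Integrable (fun ω => 1 - binary h Ts η Ith l ω) μ :=
    (integrable_const 1).sub (hh.integrable_binary hη _)
  rw [integral_const_mul, integral_finsetSum _ fun l _ => i l, ← sum_Icc_two_const hL]
  congr 1
  refine Finset.sum_congr rfl fun l _ => ?_
  rw [integral_sub (integrable_const 1) (hh.integrable_binary hη _), hh.integral_binary hη hI]
  simp

lemma IsRayleighChannel.imiCDF_eq (hh : IsRayleighChannel μ h ρ) (hη : 0 < η)
    (hI : 0 ≤ Ith) (l : ℕ) :
    imiCDF μ h Ts η l Ith = 1 - Real.exp (-((2 ^ Ith - 1) / η)) := by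
  simp only [imiCDF, imi_le_iff hη]
  exact measureReal_norm_sq_le (hh.gaussian.aemeasurable _) (hh.map_eq _) (threshold_nonneg hη hI)

lemma IsRayleighChannel.lcr_eq (hh : IsRayleighChannel μ h ρ) (hη : 0 < η)
    (hI : 0 ≤ Ith) (hρ : ‖ρ Ts‖ < 1) {L : ℕ} (hL : 2 ≤ L) :
    lcr μ h Ts η Ith L =
      (Real.exp (-((2 ^ Ith - 1) / η)) - jointExceedance ‖ρ Ts‖ η Ith) / Ts := by
  have hL1 : (0 : ℝ) < (L : ℝ) - 1 := by
    have : (2 : ℝ) ≤ L := by exact_mod_cast hL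
    linarith
  rw [lcr, hh.integral_downCrossings hη hI hρ hL, mul_div_mul_left _ _ hL1.ne']

lemma IsRayleighChannel.crossingRate_eq (hh : IsRayleighChannel μ h ρ) (hη : 0 < η)
    (hI : 0 ≤ Ith) (hρ : ‖ρ Ts‖ < 1) {L : ℕ} (hL : 2 ≤ L) :
    crossingRate μ h Ts η Ith L = 2 * lcr μ h Ts η Ith L := by
  have hL1 : (0 : ℝ) < (L : ℝ) - 1 := by
    have : (2 : ℝ) ≤ L := by exact_mod_cast hL
    linarith
  rw [hh.lcr_eq hη hI hρ hL, crossingRate, hh.integral_crossings hη hI hρ hL,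
    mul_div_mul_left _ _ hL1.ne', mul_div_assoc]

/-- The common factor `L - 1` cancels. At `Ith = 0` both sides are `0 / 0 = 0`, so no strict
threshold is required. -/
lemma IsRayleighChannel.aod_div_eq (hh : IsRayleighChannel μ h ρ) (hTs : 0 < Ts) (hη : 0 < η)
    (hI : 0 ≤ Ith) (hρ : ‖ρ Ts‖ < 1) {L : ℕ} (hL : 2 ≤ L) :
    aod μ h Ts η Ith L / Ts = (1 - Real.exp (-((2 ^ Ith - 1) / η))) /
      (Real.exp (-((2 ^ Ith - 1) / η)) - jointExceedance ‖ρ Ts‖ η Ith) := by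
  have hL1 : (0 : ℝ) < (L : ℝ) - 1 := by
    have : (2 : ℝ) ≤ L := by exact_mod_cast hL
    linarith
  rw [aod, hh.integral_downCrossings hη hI hρ hL, hh.integral_outageTime hη hI hL, mul_div_assoc,
    mul_div_cancel_left₀ _ hTs.ne', mul_div_mul_left _ _ hL1.ne']

end Channel

end SISO

theorem mainTheorem2 {Ω : Type*} [MeasurableSpace Ω] (μ : Measure Ω) [IsProbabilityMeasure μ]
    (h : ℝ → Ω → ℂ) (ρ : ℝ → ℂ) (hh : SISO.IsRayleighChannel μ h ρ)
    (Ts η Ith : ℝ) (hTs : 0 < Ts) (hη : 0 < η) (hI : 0 ≤ Ith)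
    (ϱ₁ : ℝ) (hϱ₁ : ϱ₁ = ‖ρ Ts‖) (hlt : ϱ₁ < 1) :
    -- the series in the formula converges
    Summable (fun k : ℕ =>
      (ϱ₁ ^ k / (k.factorial : ℝ) *
        SISO.upperGamma ((k : ℝ) + 1) ((2 ^ Ith - 1) / (η * (1 - ϱ₁ ^ 2)))) ^ 2) ∧
    -- the level-crossing rate
    (∀ L : ℕ, 2 ≤ L →
      SISO.lcr μ h Ts η Ith L =
        (Real.exp (-((2 ^ Ith - 1) / η)) -
          (1 - ϱ₁ ^ 2) * ∑' k : ℕ,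
            (ϱ₁ ^ k / (k.factorial : ℝ) *
              SISO.upperGamma ((k : ℝ) + 1) ((2 ^ Ith - 1) / (η * (1 - ϱ₁ ^ 2)))) ^ 2) / Ts ∧
      SISO.crossingRate μ h Ts η Ith L = 2 * SISO.lcr μ h Ts η Ith L ∧
      ∀ l : ℕ, 2 ≤ l →
        SISO.lcr μ h Ts η Ith L =
          (μ.real {ω | SISO.binary h Ts η Ith l ω = 1} -
            μ.real {ω | SISO.binary h Ts η Ith l ω = 1 ∧
              SISO.binary h Ts η Ith (l - 1) ω = 1}) / Ts) ∧
    -- the cumulative distribution function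
    (∀ l : ℕ, 1 ≤ l →
      SISO.imiCDF μ h Ts η l Ith = 1 - Real.exp (-((2 ^ Ith - 1) / η))) ∧
    -- the average outage duration, at a positive threshold
    (0 < Ith → ∀ L : ℕ, 2 ≤ L →
      0 < SISO.lcr μ h Ts η Ith L ∧
      (∀ l : ℕ, 1 ≤ l →
        SISO.aod μ h Ts η Ith L / Ts =
          SISO.imiCDF μ h Ts η l Ith / (Ts * SISO.lcr μ h Ts η Ith L)) ∧
      SISO.aod μ h Ts η Ith L / Ts =
        (1 - Real.exp (-((2 ^ Ith - 1) / η))) /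
          (Real.exp (-((2 ^ Ith - 1) / η)) -
            (1 - ϱ₁ ^ 2) * ∑' k : ℕ,
              (ϱ₁ ^ k / (k.factorial : ℝ) *
                SISO.upperGamma ((k : ℝ) + 1)
                  ((2 ^ Ith - 1) / (η * (1 - ϱ₁ ^ 2)))) ^ 2)) := by
  subst hϱ₁
  have hs : 1 - ‖ρ Ts‖ ^ 2 ≠ 0 := by nlinarith [norm_nonneg (ρ Ts)]
  refine ⟨?_, fun L hL => ⟨hh.lcr_eq hη hI hlt hL, hh.crossingRate_eq hη hI hlt hL,
    fun l hl => ?_⟩, fun l _ => hh.imiCDF_eq hη hI l, fun hI' L hL => ⟨?_, fun l _ => ?_,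
      hh.aod_div_eq hTs hη hI hlt hL⟩⟩
  -- The joint series carries the nonzero factor `1 - ϱ₁²`; `le_rfl` picks the sample pair `(0, 1)`.
  · exact (summable_mul_left_iff hs).1 (hh.hasSum_joint hη hI hlt le_rfl).summable
  · rw [hh.measureReal_binary hη hI, hh.measureReal_joint hη hI hlt (one_le_two.trans hl),
      hh.lcr_eq hη hI hlt hL]
  · rw [hh.lcr_eq hη hI hlt hL]
    exact div_pos (sub_pos.2 (hh.jointExceedance_lt hη hI' hlt)) hTs
  · rw [hh.aod_div_eq hTs hη hI hlt hL, hh.imiCDF_eq hη hI, hh.lcr_eq hη hI hlt hL,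
      mul_div_cancel₀ _ hTs.ne']
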